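/- Let $D$ be a quaternion division algebra over $\mathbb{Q}$ (a central division $\mathbb{Q}$-algebra of dimension $4$) that splits over $\mathbb{R}$, and fix an isomorphism of $\mathbb{R}$-algebras $\Phi : D\otimes_{\mathbb{Q}}\mathbb{R}\to \mathrm{M}_2(\mathbb{R})$. It identifies the group $\mathbf{SL}_{1,D}(\mathbb{R})$ of elements of reduced norm $1$ in $D\otimes_{\mathbb{Q}}\mathbb{R}$ with $\mathrm{SL}_2(\mathbb{R})$. Let $n\ge 0$ and let $\varphi$ be a (not necessarily irreducible) linear representation of $\mathrm{SL}_2(\mathbb{R})=\mathbf{SL}_{1,D}(\mathbb{R})$ on $\mathbb{R}^n$ which is defined over $\mathbb{Q}$; that is, for some basis of $\mathbb{R}^n$ the matrix entries of $\varphi(g)$, $g\in\mathbf{SL}_{1,D}(\mathbb{R})$, are given by polynomials with rational coefficients in the coordinates of $g$ with respect to a $\mathbb{Q}$-basis of $D$. Then the group $\mathbb{R}^n\rtimes_\varphi\mathrm{SL}_2(\mathbb{R})$, with the product topology, has a cocompact lattice: a discrete subgroup $\Gamma$ of finite covolume with respect to Haar measure such that $(\mathbb{R}^n\rtimes_\varphi\mathrm{SL}_2(\mathbb{R}))/\Gamma$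 is compact. -/

import Mathlib

open MeasureTheory Module
open scoped TensorProduct MatrixGroups

noncomputable section

namespace SemidirectLattice

/-! ### The real points of the group of reduced norm one elements -/

section NormOne

variable {D : Type*} [DivisionRing D] [Algebra ℚ D]

/-- The reduced norm on `D_ℝ = ℝ ⊗ D`: the determinant of the image of an element under a splitting
`Φ : ℝ ⊗ D ≃ M₂(ℝ)` (it does not depend on the choice of `Φ`). -/
def reducedNorm (Φ : ℝ ⊗[ℚ] D ≃ₐ[ℝ] Matrix (Fin 2) (Fin 2) ℝ) : (ℝ ⊗[ℚ] D) →* ℝ :=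
  Matrix.detMonoidHom.comp (Φ : (ℝ ⊗[ℚ] D) →* Matrix (Fin 2) (Fin 2) ℝ)

/-- The group `SL_{1,D}(ℝ)` of units of reduced norm `1` in `ℝ ⊗ D`. -/
def SL1 (Φ : ℝ ⊗[ℚ] D ≃ₐ[ℝ] Matrix (Fin 2) (Fin 2) ℝ) : Subgroup (ℝ ⊗[ℚ] D)ˣ :=
  (Units.map (reducedNorm Φ)).ker

theorem mem_SL1 {Φ : ℝ ⊗[ℚ] D ≃ₐ[ℝ] Matrix (Fin 2) (Fin 2) ℝ} {x : (ℝ ⊗[ℚ] D)ˣ} :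
    x ∈ SL1 Φ ↔ (Φ x).det = 1 := by
  rw [SL1, MonoidHom.mem_ker, Units.ext_iff]
  rfl

/-- The identification `SL_{1,D}(ℝ) = SL₂(ℝ)` given by the splitting `Φ`. -/
def SL1.equiv (Φ : ℝ ⊗[ℚ] D ≃ₐ[ℝ] Matrix (Fin 2) (Fin 2) ℝ) : SL1 Φ ≃* SL(2, ℝ) where
  toFun x := ⟨Φ (x : (ℝ ⊗[ℚ] D)ˣ), mem_SL1.1 x.2⟩
  invFun g := ⟨⟨Φ.symm g, Φ.symm (g⁻¹ : SL(2, ℝ)),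
      by rw [← map_mul, ← Matrix.SpecialLinearGroup.coe_mul]; simp,
      by rw [← map_mul, ← Matrix.SpecialLinearGroup.coe_mul]; simp⟩,
    mem_SL1.2 (by simp)⟩
  left_inv x := by ext; simp
  right_inv g := by ext; simp
  map_mul' _ _ := Subtype.ext (map_mul Φ _ _)

/-- A real representation `φ` of `SL₂(ℝ) = SL_{1,D}(ℝ)` on `ℝⁿ` is defined over `ℚ`, for the
`ℚ`-structure on `SL₂(ℝ)` given by `D`: for some basis `v` of `ℝⁿ`, the matrix entries of `φ`
with respect to `v` are given on `SL_{1,D}(ℝ)` by polynomials with rational coefficients in the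
coordinates of `ℝ ⊗ D` with respect to a `ℚ`-basis `e` of `D`. -/
def IsDefinedOverRat (Φ : ℝ ⊗[ℚ] D ≃ₐ[ℝ] Matrix (Fin 2) (Fin 2) ℝ) {n : ℕ}
    (φ : Representation ℝ SL(2, ℝ) (Fin n → ℝ)) : Prop :=
  ∃ (e : Basis (Fin 4) ℚ D) (v : Basis (Fin n) ℝ (Fin n → ℝ))
    (P : Fin n → Fin n → MvPolynomial (Fin 4) ℚ),
    ∀ (g : SL1 Φ) (i j : Fin n),
      LinearMap.toMatrix v v (φ (SL1.equiv Φ g)) i j =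
        MvPolynomial.aeval (fun k => (e.baseChange ℝ).repr ((g : (ℝ ⊗[ℚ] D)ˣ) : ℝ ⊗[ℚ] D) k)
          (P i j)

end NormOne

/-! ### The semidirect product -/

/-- The action by group automorphisms of `G` on the additive group of `ℝⁿ` underlying a
representation. -/
def actionHom {G : Type*} [Group G] {n : ℕ} (φ : Representation ℝ G (Fin n → ℝ)) :
    G →* MulAut (Multiplicative (Fin n → ℝ)) where
  toFun g := AddEquiv.toMultiplicative
    { toFun := φ g
      invFun := φ g⁻¹
      left_inv := fun x => by simp
      right_inv := fun x => by simp
      map_add' := map_add (φ g) }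
  map_one' := by ext; simp
  map_mul' g h := by ext; simp

/-- The group `ℝⁿ ⋊_φ G`. -/
abbrev VectorSemidirect {G : Type*} [Group G] {n : ℕ} (φ : Representation ℝ G (Fin n → ℝ)) :
    Type _ :=
  Multiplicative (Fin n → ℝ) ⋊[actionHom φ] G

/-- A semidirect product carries the product topology. -/
instance {N G : Type*} [Group N] [Group G] [TopologicalSpace N] [TopologicalSpace G]
    (α : G →* MulAut N) : TopologicalSpace (N ⋊[α] G) :=
  TopologicalSpace.induced (fun x => (x.left, x.right)) inferInstance

/-! ### Lattices -/

/-- A lattice: a discrete subgroup of finite covolume, that is, with a fundamental domain of finite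
Haar measure. -/
def IsLattice {G : Type*} [Group G] [TopologicalSpace G] (Γ : Subgroup G) : Prop :=
  letI : MeasurableSpace G := borel G
  DiscreteTopology Γ ∧
    ∃ μ : Measure G, μ.IsHaarMeasure ∧ ∃ F : Set G, IsFundamentalDomain Γ F μ ∧ μ F < ⊤

/-- A cocompact lattice: a lattice with compact coset space. -/
def IsCocompactLattice {G : Type*} [Group G] [TopologicalSpace G] (Γ : Subgroup G) : Prop :=
  IsLattice Γ ∧ CompactSpace (G ⧸ Γ)

end SemidirectLattice

end

/-! Rescaling a `ℚ`-basis of `D` gives a `ℤ`-lattice `L` in `M₂(ℝ)` closed under multiplication. Its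
nonzero elements are invertible because `D` is a division ring. Let `Γ₀` be the stabilizer of `L` in
`SL₂(ℝ)` under left multiplication.

`Γ₀` is cocompact (`exists_isCompact_mul_latticeStabilizer`). Left multiplication by `g` has
determinant `1` on `M₂(ℝ)`, so Minkowski gives a nonzero `x ∈ L` with `g x` in a fixed compact set
`C`. Then `det x = det (g x)` is bounded, and its square is an integer, so such `x` fall into
finitely many classes modulo `(det x)² L` with fixed determinant. If `x` and `y` share a class, `u =
x y⁻¹` lies in `Γ₀` and `g u = (g x) y⁻¹` lies in `C y⁻¹`; finitely many `y` suffice.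

Elements of `Γ₀` have coordinates of bounded denominator, since they map a fixed nonzero integer of
`L` into `L`. Hence `Γ₀` is discrete, and the rational polynomials giving `φ` have bounded
denominators on `Γ₀`. A multiple of the lattice of `v` therefore lies in a `Γ₀`-stable lattice `Λ`,
and `Λ ⋊ Γ₀` is the required subgroup (`isCocompactLattice_semidirectSubgroup`). -/

namespace SemidirectLattice

/-! ### Fundamental domains of discrete subgroups -/

section FundamentalDomain

variable {G : Type*} [Group G] [TopologicalSpace G] [IsTopologicalGroup G]
  [MeasurableSpace G] [BorelSpace G]

/-- A measurable set meeting each orbit of `Γ` in the saturation of a finite union of right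
translates of `V` exactly once. -/
theorem exists_measurableSet_section (Γ : Subgroup G) [Countable Γ] {V : Set G}
    (hV : IsOpen V) (hVΓ : ∀ a ∈ V, ∀ b ∈ V, a / b ∈ Γ → a / b = 1) (t : Finset G) :
    ∃ F : Set G, MeasurableSet F ∧ (∀ x ∈ F, ∃ c ∈ t, x / c ∈ V) ∧
      (∀ x, ∀ c ∈ t, x / c ∈ V → ∃ γ : Γ, γ • x ∈ F) ∧
      ∀ x ∈ F, ∀ γ : Γ, γ • x ∈ F → γ = 1 := by
  classical
  induction t using Finset.induction_on with
  | empty => exact ⟨∅, by simp⟩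
  | insert c t _ ih =>
    obtain ⟨F, hFm, hFt, hFc, hFu⟩ := ih
    have hW : IsOpen {x : G | x / c ∈ V} := hV.preimage (by fun_prop : Continuous fun x : G => x / c)
    -- The new piece is `V c` minus the `Γ`-translates of `F`, a countable union of measurable sets.
    refine ⟨F ∪ ({x | x / c ∈ V} \ ⋃ γ : Γ, (fun x => γ • x) ⁻¹' F), ?_, ?_, ?_, ?_⟩
    · exact hFm.union (hW.measurableSet.diff
        (MeasurableSet.iUnion fun γ => hFm.preimage (measurable_const_smul γ)))
    · rintro x (hx | hx)
      · obtain ⟨d, hd, h⟩ := hFt x hx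
        exact ⟨d, Finset.mem_insert_of_mem hd, h⟩
      · exact ⟨c, Finset.mem_insert_self _ _, hx.1⟩
    · intro x d hd hx
      by_cases h : ∃ γ : Γ, γ • x ∈ F
      · obtain ⟨γ, hγ⟩ := h
        exact ⟨γ, Or.inl hγ⟩
      · rcases Finset.mem_insert.1 hd with rfl | hd
        · exact ⟨1, Or.inr ⟨by simpa using hx, by simpa using h⟩⟩
        · exact absurd (hFc x d hd hx) h
    · rintro x (hx | hx) γ (hγ | hγ)
      · exact hFu x hx γ hγ
      · exact absurd (Set.mem_iUnion.2 ⟨γ⁻¹, by simpa using hx⟩) hγ.2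
      · exact absurd (Set.mem_iUnion.2 ⟨γ, hγ⟩) hx.2
      -- Two points of `V c` in one orbit differ by an element of `V V⁻¹ ∩ Γ`, which is trivial.
      · have h : (γ • x) / c / (x / c) = (γ : G) := by
          rw [Subgroup.smul_def, smul_eq_mul, div_div_div_cancel_right, mul_div_cancel_right]
        have := hVΓ _ hγ.1 _ hx.1 (by rw [h]; exact γ.2)
        exact Subtype.ext (h ▸ this)

/-- A discrete subgroup whose translates of a compact set cover the group has a fundamental domain
of finite measure. -/
theorem exists_isFundamentalDomain_measure_lt_top [SecondCountableTopology G]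
    [LocallyCompactSpace G] (Γ : Subgroup G) [DiscreteTopology Γ] (μ : Measure G) [IsFiniteMeasureOnCompacts μ] {C : Set G}
    (hC : IsCompact C) (hcov : ∀ x, ∃ γ ∈ Γ, γ * x ∈ C) :
    ∃ F : Set G, IsFundamentalDomain Γ F μ ∧ μ F < ⊤ := by
  have : Countable Γ := countable_of_Lindelof_of_discrete
  obtain ⟨U, hU, hUΓ⟩ := isOpen_induced_iff.1 (isOpen_discrete ({1} : Set Γ))
  have hU1 : U ∈ nhds (1 : G) := hU.mem_nhds (by
    have : (1 : Γ) ∈ ((↑) : Γ → G) ⁻¹' U := by rw [hUΓ]; rfl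
    simpa using this)
  obtain ⟨V₁, hV₁, hV₁U⟩ := exists_nhds_split_inv hU1
  obtain ⟨V₂, hV₂, hV₂1⟩ := exists_compact_mem_nhds (1 : G)
  set V := interior (V₁ ∩ V₂)
  have h1V : (1 : G) ∈ V := mem_interior_iff_mem_nhds.2 (Filter.inter_mem hV₁ hV₂1)
  have hVV : V ⊆ V₁ ∩ V₂ := interior_subset
  have hVΓ : ∀ a ∈ V, ∀ b ∈ V, a / b ∈ Γ → a / b = 1 := fun a ha b hb hab => by
    have : (⟨a / b, hab⟩ : Γ) ∈ ((↑) : Γ → G) ⁻¹' U := hV₁U a (hVV ha).1 b (hVV hb).1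
    rw [hUΓ] at this
    exact congrArg Subtype.val this
  obtain ⟨t, -, ht⟩ := hC.elim_nhds_subcover (fun c => {x | x / c ∈ V}) fun c _ =>
    (isOpen_interior.preimage (by fun_prop : Continuous fun x : G => x / c)).mem_nhds
      (show c / c ∈ V by rwa [div_self'])
  obtain ⟨F, hFm, hFt, hFc, hFu⟩ := exists_measurableSet_section Γ isOpen_interior hVΓ t
  refine ⟨F, IsFundamentalDomain.mk' hFm.nullMeasurableSet fun x => ?_, ?_⟩
  · obtain ⟨γ, hγ, hx⟩ := hcov x
    obtain ⟨c, hc, hxc⟩ := Set.mem_iUnion₂.1 (ht hx)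
    obtain ⟨δ, hδ⟩ := hFc _ c hc hxc
    refine ⟨δ * ⟨γ, hγ⟩, by simpa [mul_smul, Subgroup.smul_def] using hδ, fun ε hε => ?_⟩
    have hδ' : (δ * ⟨γ, hγ⟩ : Γ) • x ∈ F := by simpa [mul_smul, Subgroup.smul_def] using hδ
    have := hFu _ hδ' (ε * (δ * ⟨γ, hγ⟩ : Γ)⁻¹) (by rwa [smul_smul, inv_mul_cancel_right])
    exact mul_inv_eq_one.1 this
  · have hK : IsCompact (⋃ c ∈ t, (fun x => x * c) '' V₂) :=
      t.isCompact_biUnion fun c _ => hV₂.image (by fun_prop)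
    refine (measure_mono fun x hx => ?_).trans_lt hK.measure_lt_top
    obtain ⟨c, hc, hxc⟩ := hFt x hx
    exact Set.mem_iUnion₂.2 ⟨c, hc, x / c, (hVV hxc).2, by simp⟩

end FundamentalDomain

/-- A discrete subgroup `Γ` with `G = KΓ` for a compact set `K` is a cocompact lattice. -/
theorem isCocompactLattice_of_isCompact {G : Type*} [Group G] [TopologicalSpace G]
    [IsTopologicalGroup G] [SecondCountableTopology G] [LocallyCompactSpace G] (Γ : Subgroup G)
    [DiscreteTopology Γ] {K : Set G} (hK : IsCompact K) (hcov : ∀ x, ∃ k ∈ K, ∃ γ ∈ Γ, x = k * γ) :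
    IsCocompactLattice Γ := by
  let _ : MeasurableSpace G := borel G
  have : BorelSpace G := ⟨rfl⟩
  refine ⟨⟨inferInstance, Measure.haar, inferInstance, ?_⟩, ?_⟩
  -- Fundamental domains refer to left translation by `Γ`, so the covering `G = KΓ` is inverted.
  · refine exists_isFundamentalDomain_measure_lt_top Γ _ hK.inv fun x => ?_
    obtain ⟨k, hk, γ, hγ, h⟩ := hcov x⁻¹
    refine ⟨γ, hγ, ?_⟩
    rw [← inv_inv x, h]
    simpa using hk
  · have : (QuotientGroup.mk '' K : Set (G ⧸ Γ)) = Set.univ := by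
      refine Set.eq_univ_of_forall fun q => ?_
      obtain ⟨x, rfl⟩ := QuotientGroup.mk_surjective q
      obtain ⟨k, hk, γ, hγ, rfl⟩ := hcov x
      exact ⟨k, hk, by simp [hγ]⟩
    exact ⟨this ▸ hK.image QuotientGroup.continuous_mk⟩

/-! ### Topology of semidirect products -/

section SemidirectTopology

variable {N G : Type*} [Group N] [Group G] [TopologicalSpace N] [TopologicalSpace G]
  {α : G →* MulAut N}

theorem isInducing_left_right : Topology.IsInducing fun x : N ⋊[α] G => (x.left, x.right) :=
  ⟨rfl⟩

theorem continuous_left : Continuous fun x : N ⋊[α] G => x.left :=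
  continuous_fst.comp isInducing_left_right.continuous

theorem continuous_right : Continuous fun x : N ⋊[α] G => x.right :=
  continuous_snd.comp isInducing_left_right.continuous

variable (α) in
/-- The semidirect product is homeomorphic to the product. -/
def semidirectHomeomorph : N ⋊[α] G ≃ₜ N × G where
  toEquiv := SemidirectProduct.equivProd
  continuous_toFun := isInducing_left_right.continuous
  continuous_invFun := isInducing_left_right.continuous_iff.2 continuous_id

theorem isTopologicalGroup_semidirect [IsTopologicalGroup N] [IsTopologicalGroup G]
    (hα : Continuous fun p : G × N => α p.1 p.2) : IsTopologicalGroup (N ⋊[α] G) where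
  continuous_mul := isInducing_left_right.continuous_iff.2 <| by
    refine Continuous.prodMk ?_ ?_
    · exact (continuous_left.comp continuous_fst).mul (hα.comp
        ((continuous_right.comp continuous_fst).prodMk (continuous_left.comp continuous_snd)))
    · exact (continuous_right.comp continuous_fst).mul (continuous_right.comp continuous_snd)
  continuous_inv := isInducing_left_right.continuous_iff.2 <| by
    exact (hα.comp (continuous_right.inv.prodMk continuous_left.inv)).prodMk continuous_right.inv

end SemidirectTopology

/-! ### Minkowski's theorem and determinants of left multiplication -/

/-- Minkowski's theorem for the image of `ℤ^d` under a linear map of determinant `±1`. -/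
theorem exists_int_ne_zero_norm_le_one {d : ℕ} [NeZero d] (T : (Fin d → ℝ) →ₗ[ℝ] (Fin d → ℝ))
    (hT : |LinearMap.det T| = 1) : ∃ z : Fin d → ℤ, z ≠ 0 ∧ ‖T fun i => (z i : ℝ)‖ ≤ 1 := by
  have hdet : LinearMap.det T ≠ 0 := fun h => by simp [h] at hT
  set b := Pi.basisFun ℝ (Fin d)
  let e : (Fin d → ℝ) ≃L[ℝ] (Fin d → ℝ) := (T.equivOfDetNeZero hdet).toContinuousLinearEquiv
  have he : ∀ x, e x = T x := fun _ => rfl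
  have hcpt : IsCompact (T ⁻¹' Metric.closedBall 0 1) :=
    e.toHomeomorph.isCompact_preimage.2 (isCompact_closedBall _ _)
  have : Countable (Submodule.span ℤ (Set.range b)).toAddSubgroup :=
    countable_of_Lindelof_of_discrete
  obtain ⟨x, hx0, hx⟩ := exists_ne_zero_mem_lattice_of_measure_mul_two_pow_le_measure
    (ZSpan.isAddFundamentalDomain' b volume) (s := T ⁻¹' Metric.closedBall 0 1)
    (fun x hx => by simpa using hx) ((convex_closedBall 0 1).linear_preimage T) hcpt
    (by
      -- The unit ball of the sup norm has volume exactly `2 ^ d`; compactness allows equality in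
      -- Minkowski's bound.
      rw [Measure.addHaar_preimage_linearMap _ hdet, abs_inv, hT, ZSpan.fundamentalDomain_pi_basisFun,
        volume_pi, Measure.pi_pi, ← volume_pi, Real.volume_pi_closedBall _ zero_le_one]
      simp)
  have hmem : (x : Fin d → ℝ) ∈ Submodule.span ℤ (Set.range b) := x.2
  choose z hz using (b.mem_span_iff_repr_mem ℤ _).1 hmem
  have hzx : (fun i => (z i : ℝ)) = (x : Fin d → ℝ) := funext fun i => by simpa [b] using hz i
  refine ⟨z, fun h => hx0 (Subtype.ext ?_), ?_⟩
  · rw [← hzx, h]; ext; simp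
  · rw [hzx]; simpa using hx

/-- The determinant of left multiplication on `2 × 2` matrices. -/
theorem det_leftMulMatrix_eq_sq (b : Basis (Fin 4) ℝ (Matrix (Fin 2) (Fin 2) ℝ))
    (x : Matrix (Fin 2) (Fin 2) ℝ) : (Algebra.leftMulMatrix b x).det = x.det ^ 2 := by
  rw [← Algebra.norm_eq_matrix_det,
    Algebra.norm_eq_matrix_det (Matrix.stdBasis ℝ (Fin 2) (Fin 2))]
  -- Left multiplication acts on the two columns separately.
  have : Algebra.leftMulMatrix (Matrix.stdBasis ℝ (Fin 2) (Fin 2)) x =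
      Matrix.kroneckerMap (· * ·) x 1 := by
    ext ⟨i, j⟩ ⟨k, l⟩
    rw [Algebra.leftMulMatrix_eq_repr_mul, Matrix.stdBasis_eq_single]
    fin_cases i <;> fin_cases j <;> fin_cases k <;> fin_cases l <;>
      simp [Matrix.stdBasis, Matrix.mul_apply, Matrix.single]
  rw [this, Matrix.det_kronecker]
  simp
-- Cocompactness of the stabilizer of a multiplicative lattice
section MatrixLattice

variable (b : Basis (Fin 4) ℝ (Matrix (Fin 2) (Fin 2) ℝ))

/-- The `ℤ`-lattice of `2 × 2` matrices spanned by a basis. -/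
abbrev matrixLattice : Submodule ℤ (Matrix (Fin 2) (Fin 2) ℝ) := Submodule.span ℤ (Set.range b)

/-- The stabilizer in `SL₂(ℝ)` of the lattice spanned by `b`, for left multiplication. -/
def latticeStabilizer : Subgroup SL(2, ℝ) where
  carrier := {g | ∀ x ∈ matrixLattice b, (g : Matrix (Fin 2) (Fin 2) ℝ) * x ∈ matrixLattice b ∧
    ((g⁻¹ : SL(2, ℝ)) : Matrix (Fin 2) (Fin 2) ℝ) * x ∈ matrixLattice b}
  one_mem' x hx := by simpa using hx
  mul_mem' {g h} hg hh x hx := by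
    rw [mul_inv_rev, Matrix.SpecialLinearGroup.coe_mul, Matrix.SpecialLinearGroup.coe_mul,
      mul_assoc, mul_assoc]
    exact ⟨(hg _ (hh x hx).1).1, (hh _ (hg x hx).2).2⟩
  inv_mem' {g} hg x hx := by
    rw [inv_inv]
    exact (hg x hx).symm

variable {b}

theorem exists_int_leftMulMatrix
    (hmul : ∀ x ∈ matrixLattice b, ∀ y ∈ matrixLattice b, x * y ∈ matrixLattice b)
    {x : Matrix (Fin 2) (Fin 2) ℝ} (hx : x ∈ matrixLattice b) :
    ∃ A : Matrix (Fin 4) (Fin 4) ℤ, Algebra.leftMulMatrix b x = A.map (Int.castRingHom ℝ) := by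
  have h := fun j => (b.mem_span_iff_repr_mem ℤ _).1
    (hmul x hx (b j) (Submodule.subset_span ⟨j, rfl⟩))
  choose A hA using h
  refine ⟨Matrix.of fun i j => A j i, ?_⟩
  ext i j
  rw [Algebra.leftMulMatrix_eq_repr_mul]
  simpa using (hA j i).symm

theorem exists_int_eq_det_sq
    (hmul : ∀ x ∈ matrixLattice b, ∀ y ∈ matrixLattice b, x * y ∈ matrixLattice b)
    {x : Matrix (Fin 2) (Fin 2) ℝ} (hx : x ∈ matrixLattice b) : ∃ m : ℤ, x.det ^ 2 = m := by
  obtain ⟨A, hA⟩ := exists_int_leftMulMatrix hmul hx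
  refine ⟨A.det, ?_⟩
  rw [← det_leftMulMatrix_eq_sq b, hA, ← RingHom.mapMatrix_apply, ← RingHom.map_det]
  rfl

/-- Left multiplication by `x` has an integer matrix of determinant `(det x)²`, so `(det x)²` times
its inverse is the adjugate, again an integer matrix. -/
theorem det_sq_smul_inv_mul_mem
    (hmul : ∀ x ∈ matrixLattice b, ∀ y ∈ matrixLattice b, x * y ∈ matrixLattice b)
    {x l : Matrix (Fin 2) (Fin 2) ℝ} (hx : x ∈ matrixLattice b) (hx0 : x.det ≠ 0)
    (hl : l ∈ matrixLattice b) : x.det ^ 2 • (x⁻¹ * l) ∈ matrixLattice b := by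
  obtain ⟨A, hA⟩ := exists_int_leftMulMatrix hmul hx
  have hinv : x.det ^ 2 • Algebra.leftMulMatrix b x⁻¹ = (Algebra.leftMulMatrix b x).adjugate := by
    have h1 : Algebra.leftMulMatrix b x * Algebra.leftMulMatrix b x⁻¹ = 1 := by
      rw [← map_mul, Matrix.mul_nonsing_inv _ hx0.isUnit, map_one]
    calc _ = x.det ^ 2 • (1 : Matrix (Fin 4) (Fin 4) ℝ) * Algebra.leftMulMatrix b x⁻¹ := by simp
      _ = _ := by
        rw [← det_leftMulMatrix_eq_sq b, ← Matrix.adjugate_mul, mul_assoc, h1, mul_one]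
  choose z hz using (b.mem_span_iff_repr_mem ℤ _).1 hl
  refine (b.mem_span_iff_repr_mem ℤ _).2 fun i => ⟨(A.adjugate.mulVec z) i, ?_⟩
  have h2 : ⇑(b.repr (x.det ^ 2 • (x⁻¹ * l))) =
      (Algebra.leftMulMatrix b x).adjugate.mulVec (b.repr l) := by
    rw [← hinv, Matrix.smul_mulVec, Algebra.leftMulMatrix_mulVec_repr]
    simp
  rw [h2, hA, ← RingHom.mapMatrix_apply, ← RingHom.map_adjugate, RingHom.mapMatrix_apply]
  simp [Matrix.mulVec, dotProduct, ← hz]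

/-- Substituting `x = y + (det y)² z` gives `x y⁻¹ l = l + z ((det y)² y⁻¹ l)`, where the bracket is
in the lattice. -/
theorem mul_inv_mul_mem
    (hmul : ∀ x ∈ matrixLattice b, ∀ y ∈ matrixLattice b, x * y ∈ matrixLattice b)
    {x y z l : Matrix (Fin 2) (Fin 2) ℝ} (hy : y ∈ matrixLattice b) (hy0 : y.det ≠ 0)
    (hz : z ∈ matrixLattice b) (hxy : x - y = y.det ^ 2 • z) (hl : l ∈ matrixLattice b) :
    x * y⁻¹ * l ∈ matrixLattice b := by
  have : x * y⁻¹ * l = l + z * (y.det ^ 2 • (y⁻¹ * l)) := by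
    rw [sub_eq_iff_eq_add'.1 hxy, add_mul, add_mul, Matrix.mul_nonsing_inv _ hy0.isUnit, one_mul]
    simp [mul_assoc]
  rw [this]
  exact add_mem hl (hmul _ hz _ (det_sq_smul_inv_mul_mem hmul hy hy0 hl))

theorem exists_mem_latticeStabilizer_mul_eq
    (hmul : ∀ x ∈ matrixLattice b, ∀ y ∈ matrixLattice b, x * y ∈ matrixLattice b)
    {x y z : Matrix (Fin 2) (Fin 2) ℝ} (hx : x ∈ matrixLattice b) (hy : y ∈ matrixLattice b)
    (hy0 : y.det ≠ 0) (hz : z ∈ matrixLattice b) (hdet : x.det = y.det)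
    (hxy : x - y = y.det ^ 2 • z) :
    ∃ u ∈ latticeStabilizer b, (u : Matrix (Fin 2) (Fin 2) ℝ) * y = x := by
  have hx0 : x.det ≠ 0 := hdet ▸ hy0
  let u : SL(2, ℝ) := ⟨x * y⁻¹, by
    rw [Matrix.det_mul, Matrix.det_nonsing_inv, hdet, Ring.mul_inverse_cancel _ hy0.isUnit]⟩
  let w : SL(2, ℝ) := ⟨y * x⁻¹, by
    rw [Matrix.det_mul, Matrix.det_nonsing_inv, hdet, Ring.mul_inverse_cancel _ hy0.isUnit]⟩
  have hw : u⁻¹ = w := by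
    refine inv_eq_of_mul_eq_one_right (Subtype.ext ?_)
    change x * y⁻¹ * (y * x⁻¹) = 1
    rw [← mul_assoc, Matrix.nonsing_inv_mul_cancel_right _ _ hy0.isUnit,
      Matrix.mul_nonsing_inv _ hx0.isUnit]
  refine ⟨u, fun l hl => ⟨mul_inv_mul_mem hmul hy hy0 hz hxy hl, ?_⟩,
    Matrix.nonsing_inv_mul_cancel_right _ _ hy0.isUnit⟩
  -- The inverse `y x⁻¹` is the same situation with `x` and `y` exchanged and `z` negated.
  rw [hw]
  refine mul_inv_mul_mem hmul hx hx0 (neg_mem hz) ?_ hl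
  rw [hdet, smul_neg, ← hxy, neg_sub]

theorem exists_mem_lattice_norm_le_one (g : SL(2, ℝ)) :
    ∃ x ∈ matrixLattice b, x ≠ 0 ∧
      ‖b.equivFun ((g : Matrix (Fin 2) (Fin 2) ℝ) * x)‖ ≤ 1 := by
  obtain ⟨z, hz0, hz⟩ := exists_int_ne_zero_norm_le_one
    (Matrix.toLin' (Algebra.leftMulMatrix b (g : Matrix (Fin 2) (Fin 2) ℝ)))
    (by rw [LinearMap.det_toLin', det_leftMulMatrix_eq_sq]; simp)
  set x := b.equivFun.symm fun i => (z i : ℝ)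
  have hx : (⇑(b.repr x) : Fin 4 → ℝ) = fun i => (z i : ℝ) := b.equivFun.apply_symm_apply _
  refine ⟨x, (b.mem_span_iff_repr_mem ℤ _).2 fun i => ⟨z i, by simp [hx]⟩, fun h => hz0 ?_, ?_⟩
  · ext i
    have := congrFun hx i
    simpa [h] using this.symm
  · rw [← hx, Matrix.toLin'_apply, Algebra.leftMulMatrix_mulVec_repr] at hz
    exact hz

theorem isCompact_norm_equivFun_le_one :
    IsCompact {x : Matrix (Fin 2) (Fin 2) ℝ | ‖b.equivFun x‖ ≤ 1} := by
  have h : Continuous b.equivFun.symm := LinearMap.continuous_of_finiteDimensional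
    (b.equivFun.symm : (Fin 4 → ℝ) →ₗ[ℝ] Matrix (Fin 2) (Fin 2) ℝ)
  convert! (isCompact_closedBall (0 : Fin 4 → ℝ) 1).image h using 1
  ext x
  constructor
  · exact fun hx => ⟨b.equivFun x, by simpa using hx, b.equivFun.symm_apply_apply x⟩
  · rintro ⟨y, hy, rfl⟩
    rw [Set.mem_ofPred_eq, b.equivFun.apply_symm_apply]
    simpa using hy

theorem finite_setOf_sq_eq_int_of_abs_le (B : ℝ) :
    {t : ℝ | (∃ m : ℤ, t ^ 2 = m) ∧ |t| ≤ B}.Finite := by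
  refine (((Set.finite_Icc (0 : ℤ) ⌈B ^ 2⌉).image fun m : ℤ => √(m : ℝ)).union
    ((Set.finite_Icc (0 : ℤ) ⌈B ^ 2⌉).image fun m : ℤ => -√(m : ℝ))).subset ?_
  rintro t ⟨⟨m, hm⟩, ht⟩
  have hm0 : 0 ≤ m := by exact_mod_cast hm ▸ sq_nonneg t
  have hmB : m ≤ ⌈B ^ 2⌉ := by
    have : (m : ℝ) ≤ ⌈B ^ 2⌉ := hm ▸ (sq_le_sq' (by linarith [neg_abs_le t, abs_le.1 ht])
      (abs_le.1 ht).2).trans (Int.le_ceil _)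
    exact_mod_cast this
  rcases le_total 0 t with h | h
  · exact Or.inl ⟨m, ⟨hm0, hmB⟩, by simp [← hm, Real.sqrt_sq h]⟩
  · exact Or.inr ⟨m, ⟨hm0, hmB⟩, by simp [← hm, Real.sqrt_sq_eq_abs, abs_of_nonpos h]⟩

/-- Lattice elements of bounded determinant form finitely many classes up to congruence modulo the
square of the determinant. -/
theorem exists_finite_congruent
    (hmul : ∀ x ∈ matrixLattice b, ∀ y ∈ matrixLattice b, x * y ∈ matrixLattice b)
    (hdet : ∀ x ∈ matrixLattice b, x ≠ 0 → x.det ≠ 0)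
    {S : Set (Matrix (Fin 2) (Fin 2) ℝ)} {B : ℝ}
    (hS : ∀ x ∈ S, x ∈ matrixLattice b ∧ x ≠ 0 ∧ |x.det| ≤ B) :
    ∃ T ⊆ S, T.Finite ∧ ∀ x ∈ S, ∃ y ∈ T, x.det = y.det ∧
      ∃ z ∈ matrixLattice b, x - y = y.det ^ 2 • z := by
  -- On the lattice the coordinates and `det ^ 2` are already integers; the floors only move them to
  -- `ℤ`.
  let f : Matrix (Fin 2) (Fin 2) ℝ → ℝ × (Fin 4 → ℤ) :=
    fun x => (x.det, fun i => ⌊b.repr x i⌋ % ⌊x.det ^ 2⌋)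
  -- `T` picks one representative for each value of `f` on `S`.
  obtain ⟨T, hTS, hT⟩ := Set.exists_subset_bijOn S f
  have hfin : (f '' S).Finite := by
    refine ((finite_setOf_sq_eq_int_of_abs_le B).prod
      (Set.Finite.pi' fun _ : Fin 4 => Set.finite_Icc (0 : ℤ) ⌈B ^ 2⌉)).subset ?_
    rintro _ ⟨x, hx, rfl⟩
    obtain ⟨hxL, hx0, hxB⟩ := hS x hx
    obtain ⟨m, hm⟩ := exists_int_eq_det_sq hmul hxL
    refine ⟨⟨⟨m, hm⟩, hxB⟩, fun i => ?_⟩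
    have hm0 : (0 : ℤ) < m := by
      have : (0 : ℝ) < m := hm ▸ sq_pos_of_ne_zero (hdet x hxL hx0)
      exact_mod_cast this
    have hmB : m ≤ ⌈B ^ 2⌉ := by
      have : (m : ℝ) ≤ ⌈B ^ 2⌉ := hm ▸ (sq_le_sq' (by linarith [neg_abs_le x.det, abs_le.1 hxB])
        (abs_le.1 hxB).2).trans (Int.le_ceil _)
      exact_mod_cast this
    change _ % ⌊x.det ^ 2⌋ ∈ _
    rw [hm, Int.floor_intCast]
    exact ⟨Int.emod_nonneg _ hm0.ne', (Int.emod_lt_of_pos _ hm0).le.trans hmB⟩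
  refine ⟨T, hTS, hT.finite_iff_finite.2 hfin, fun x hx => ?_⟩
  obtain ⟨y, hy, hyx⟩ := hT.surjOn ⟨x, hx, rfl⟩
  have hd : y.det = x.det := congrArg Prod.fst hyx
  obtain ⟨hxL, -, -⟩ := hS x hx
  obtain ⟨hyL, hy0, -⟩ := hS y (hTS hy)
  have hy0' := hdet y hyL hy0
  refine ⟨y, hy, hd.symm, (y.det ^ 2)⁻¹ • (x - y), ?_, by rw [smul_inv_smul₀ (pow_ne_zero 2 hy0')]⟩
  obtain ⟨m, hm⟩ := exists_int_eq_det_sq hmul hyL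
  have hm0 : (m : ℝ) ≠ 0 := hm ▸ pow_ne_zero 2 hy0'
  refine (b.mem_span_iff_repr_mem ℤ _).2 fun i => ?_
  obtain ⟨p, hp⟩ := (b.mem_span_iff_repr_mem ℤ _).1 hxL i
  obtain ⟨q, hq⟩ := (b.mem_span_iff_repr_mem ℤ _).1 hyL i
  have hi : ⌊b.repr y i⌋ % ⌊y.det ^ 2⌋ = ⌊b.repr x i⌋ % ⌊x.det ^ 2⌋ :=
    congrFun (congrArg Prod.snd hyx) i
  simp only [algebraMap_int_eq, eq_intCast] at hp hq
  rw [← hd, hm, ← hp, ← hq, Int.floor_intCast, Int.floor_intCast, Int.floor_intCast] at hi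
  obtain ⟨k, hk⟩ := Int.ModEq.dvd hi
  refine ⟨k, ?_⟩
  have hk' : (p : ℝ) - q = m * k := by exact_mod_cast hk
  rw [hm, map_smul, map_sub, Finsupp.smul_apply, Finsupp.sub_apply, ← hp, ← hq, hk', smul_eq_mul,
    inv_mul_cancel_left₀ hm0]
  simp

/-- The stabilizer of a lattice closed under multiplication without zero divisors is cocompact. -/
theorem exists_isCompact_mul_latticeStabilizer
    (hmul : ∀ x ∈ matrixLattice b, ∀ y ∈ matrixLattice b, x * y ∈ matrixLattice b)
    (hdet : ∀ x ∈ matrixLattice b, x ≠ 0 → x.det ≠ 0) :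
    ∃ K : Set SL(2, ℝ), IsCompact K ∧
      ∀ g, ∃ k ∈ K, ∃ γ ∈ latticeStabilizer b, g = k * γ := by
  set C := {x : Matrix (Fin 2) (Fin 2) ℝ | ‖b.equivFun x‖ ≤ 1}
  have hC : IsCompact C := isCompact_norm_equivFun_le_one
  obtain ⟨B, hB⟩ := hC.exists_bound_of_continuousOn (f := Matrix.det)
    (continuous_id.matrix_det).continuousOn
  let S : Set (Matrix (Fin 2) (Fin 2) ℝ) := {x | x ∈ matrixLattice b ∧ x ≠ 0 ∧
    ∃ g : SL(2, ℝ), (g : Matrix (Fin 2) (Fin 2) ℝ) * x ∈ C}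
  obtain ⟨T, hTS, hT, hST⟩ := exists_finite_congruent hmul hdet (S := S) (B := B)
    fun x ⟨hxL, hx0, g, hg⟩ => ⟨hxL, hx0, by simpa using hB _ hg⟩
  refine ⟨⋃ y ∈ T, (fun g : SL(2, ℝ) => (g : Matrix (Fin 2) (Fin 2) ℝ)) ⁻¹'
    ((fun c => c * y⁻¹) '' C), ?_, fun g => ?_⟩
  · exact hT.isCompact_biUnion fun y _ =>
      Matrix.SpecialLinearGroup.isClosedEmbedding_val.isCompact_preimage
        (hC.image (continuous_id.mul continuous_const))
  · obtain ⟨x, hxL, hx0, hgx⟩ := exists_mem_lattice_norm_le_one (b := b) g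
    obtain ⟨y, hy, hxy, z, hz, hxyz⟩ := hST x ⟨hxL, hx0, g, hgx⟩
    obtain ⟨hyL, hy0, -⟩ := hTS hy
    have hy0' := hdet y hyL hy0
    obtain ⟨u, hu, huy⟩ := exists_mem_latticeStabilizer_mul_eq hmul hxL hyL hy0' hz hxy hxyz
    refine ⟨g * u, Set.mem_iUnion₂.2 ⟨y, hy, g * x, hgx, ?_⟩, u⁻¹, inv_mem hu, by simp⟩
    change (g : Matrix (Fin 2) (Fin 2) ℝ) * x * y⁻¹ = _
    rw [← huy, ← mul_assoc, Matrix.mul_nonsing_inv_cancel_right _ _ hy0'.isUnit]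
    exact (Matrix.SpecialLinearGroup.coe_mul g u).symm

end MatrixLattice

/-! ### The lattice in the semidirect product -/

section SemidirectLattice

variable {G : Type*} [Group G] {n : ℕ} (φ : Representation ℝ G (Fin n → ℝ))
  (v : Basis (Fin n) ℝ (Fin n → ℝ)) (Γ₀ : Subgroup G)

/-- The largest `Γ₀`-stable subgroup of the lattice spanned by `v`. -/
def stableLattice : AddSubgroup (Fin n → ℝ) where
  carrier := {x | ∀ g ∈ Γ₀, φ g x ∈ Submodule.span ℤ (Set.range v)}
  zero_mem' g _ := by simp
  add_mem' hx hy g hg := by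
    rw [map_add]
    exact add_mem (hx g hg) (hy g hg)
  neg_mem' hx g hg := by
    rw [map_neg]
    exact neg_mem (hx g hg)

theorem mem_stableLattice {x : Fin n → ℝ} : x ∈ stableLattice φ v Γ₀ ↔
    ∀ g ∈ Γ₀, φ g x ∈ Submodule.span ℤ (Set.range v) := Iff.rfl

variable {φ v Γ₀} in
theorem map_mem_stableLattice {x : Fin n → ℝ} {g : G} (hg : g ∈ Γ₀)
    (hx : x ∈ stableLattice φ v Γ₀) : φ g x ∈ stableLattice φ v Γ₀ := fun h hh => by
  rw [← Module.End.mul_apply, ← map_mul]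
  exact hx _ (mul_mem hh hg)

variable {φ v Γ₀} in
theorem mem_span_of_mem_stableLattice {x : Fin n → ℝ} (hx : x ∈ stableLattice φ v Γ₀) :
    x ∈ Submodule.span ℤ (Set.range v) := by
  simpa using hx 1 (one_mem _)

/-- The semidirect product of the stable lattice with `Γ₀`. -/
def semidirectSubgroup : Subgroup (VectorSemidirect φ) where
  carrier := {x | x.left.toAdd ∈ stableLattice φ v Γ₀ ∧ x.right ∈ Γ₀}
  one_mem' := ⟨zero_mem _, one_mem _⟩
  mul_mem' hx hy := ⟨add_mem hx.1 (map_mem_stableLattice hx.2 hy.1), mul_mem hx.2 hy.2⟩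
  inv_mem' hx := ⟨map_mem_stableLattice (inv_mem hx.2) (neg_mem hx.1), inv_mem hx.2⟩

theorem discreteTopology_semidirectSubgroup [TopologicalSpace G] [DiscreteTopology Γ₀] :
    DiscreteTopology (semidirectSubgroup φ v Γ₀) := by
  let f : semidirectSubgroup φ v Γ₀ → Submodule.span ℤ (Set.range v) × Γ₀ := fun x =>
    (⟨x.1.left.toAdd, mem_span_of_mem_stableLattice x.2.1⟩, ⟨x.1.right, x.2.2⟩)
  refine DiscreteTopology.of_continuous_injective (f := f) (Continuous.prodMk ?_ ?_) ?_
  · exact (continuous_toAdd.comp (continuous_left.comp continuous_subtype_val)).subtype_mk _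
  · exact (continuous_right.comp continuous_subtype_val).subtype_mk _
  · intro x y h
    refine Subtype.ext (SemidirectProduct.ext ?_ ?_)
    · exact congrArg (fun z => (z.1 : Fin n → ℝ)) h
    · exact congrArg (fun z => (z.2 : G)) h

theorem isCocompactLattice_semidirectSubgroup [TopologicalSpace G] [IsTopologicalGroup G]
    [SecondCountableTopology G] [LocallyCompactSpace G] [DiscreteTopology Γ₀]
    (hφ : Continuous fun p : G × (Fin n → ℝ) => φ p.1 p.2) {K : Set G} (hK : IsCompact K)
    (hcov : ∀ g, ∃ k ∈ K, ∃ γ ∈ Γ₀, g = k * γ) {N : ℤ} (hN : N ≠ 0)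
    (hden : ∀ g ∈ Γ₀, ∀ j, (N : ℝ) • φ g (v j) ∈ Submodule.span ℤ (Set.range v)) :
    IsCocompactLattice (semidirectSubgroup φ v Γ₀) := by
  have : IsTopologicalGroup (VectorSemidirect φ) := isTopologicalGroup_semidirect hφ
  have : SecondCountableTopology (VectorSemidirect φ) :=
    isInducing_left_right.secondCountableTopology
  have : LocallyCompactSpace (VectorSemidirect φ) :=
    (semidirectHomeomorph (actionHom φ)).isClosedEmbedding.locallyCompactSpace
  have := discreteTopology_semidirectSubgroup φ v Γ₀
  have hN' : (N : ℝ) ≠ 0 := Int.cast_ne_zero.2 hN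
  -- The multiple `N v` spans a lattice inside the stable lattice, so integer parts with respect to
  -- `w` are stable vectors.
  let w : Basis (Fin n) ℝ (Fin n → ℝ) := v.unitsSMul fun _ => Units.mk0 (N : ℝ) hN'
  have hw : Submodule.span ℤ (Set.range w) ≤
      AddSubgroup.toIntSubmodule (stableLattice φ v Γ₀) := by
    rw [Submodule.span_le]
    rintro _ ⟨j, rfl⟩ g hg
    rw [Basis.unitsSMul_apply, Units.smul_def, map_smul]
    exact hden g hg j
  have hC := (ZSpan.fundamentalDomain_isBounded w).isCompact_closure
  have hcts : Continuous fun p : (Fin n → ℝ) × G =>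
      (⟨Multiplicative.ofAdd (φ p.2 p.1), p.2⟩ : VectorSemidirect φ) :=
    isInducing_left_right.continuous_iff.2 <|
      (continuous_ofAdd.comp (hφ.comp continuous_swap)).prodMk continuous_snd
  refine isCocompactLattice_of_isCompact _ ((hC.prod hK).image hcts) fun x => ?_
  obtain ⟨k, hk, γ, hγ, hx⟩ := hcov x.right
  -- Since `(φ k c, k) (l, γ) = (φ k (c + l), k γ)`, the vector to split into fractional and integer
  -- parts is `φ k⁻¹` of the left component.
  set y := φ k⁻¹ x.left.toAdd
  refine ⟨_, ⟨(ZSpan.fract w y, k), ⟨subset_closure (ZSpan.fract_mem_fundamentalDomain w y), hk⟩,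
    rfl⟩, ⟨Multiplicative.ofAdd (ZSpan.floor w y : Fin n → ℝ), γ⟩,
    ⟨hw (ZSpan.floor w y).2, hγ⟩, SemidirectProduct.ext ?_ hx⟩
  change x.left.toAdd = φ k (ZSpan.fract w y) + φ k (ZSpan.floor w y)
  rw [← map_add, ZSpan.fract_apply, sub_add_cancel, ← Module.End.mul_apply, ← map_mul,
    mul_inv_cancel, map_one, Module.End.one_apply]

end SemidirectLattice

/-! ### Bounded denominators and the lattice coming from `D` -/

/-- A rational polynomial takes values of bounded denominator at points of bounded denominator. -/
theorem exists_int_mul_aeval {σ : Type*} {M : ℤ} (hM : M ≠ 0) (P : MvPolynomial σ ℚ) :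
    ∃ N : ℤ, N ≠ 0 ∧ ∀ x : σ → ℝ, (∀ k, ∃ z : ℤ, (M : ℝ) * x k = z) →
      ∃ z : ℤ, (N : ℝ) * MvPolynomial.aeval x P = z := by
  induction P using MvPolynomial.induction_on with
  | C a =>
    refine ⟨a.den, by exact_mod_cast a.den_nz, fun x _ => ⟨a.num, ?_⟩⟩
    rw [MvPolynomial.aeval_C, eq_ratCast]
    exact_mod_cast congrArg (Rat.cast : ℚ → ℝ) (Rat.den_mul_eq_num a)
  | add p q hp hq =>
    obtain ⟨N₁, h₁, hp⟩ := hp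
    obtain ⟨N₂, h₂, hq⟩ := hq
    refine ⟨N₁ * N₂, mul_ne_zero h₁ h₂, fun x hx => ?_⟩
    obtain ⟨z₁, hz₁⟩ := hp x hx
    obtain ⟨z₂, hz₂⟩ := hq x hx
    refine ⟨N₂ * z₁ + N₁ * z₂, ?_⟩
    push_cast
    rw [map_add, ← hz₁, ← hz₂]
    ring
  | mul_X p i hp =>
    obtain ⟨N, h, hp⟩ := hp
    refine ⟨N * M, mul_ne_zero h hM, fun x hx => ?_⟩
    obtain ⟨z₁, hz₁⟩ := hp x hx
    obtain ⟨z₂, hz₂⟩ := hx i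
    refine ⟨z₁ * z₂, ?_⟩
    push_cast
    rw [map_mul, MvPolynomial.aeval_X, ← hz₁, ← hz₂]
    ring

theorem exists_int_mul_rat {ι : Type*} [Finite ι] (q : ι → ℚ) :
    ∃ N : ℤ, N ≠ 0 ∧ ∀ i, ∃ z : ℤ, (N : ℚ) * q i = z := by
  obtain ⟨N, hN⟩ := IsLocalization.exist_integer_multiples_of_finite (nonZeroDivisors ℤ) q
  refine ⟨N, nonZeroDivisors.ne_zero N.2, fun i => ?_⟩
  obtain ⟨z, hz⟩ := hN i
  exact ⟨z, by simpa using hz.symm⟩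

section Order

variable {D : Type*} [DivisionRing D] [Algebra ℚ D]

theorem exists_basis_matrixLattice (Φ : ℝ ⊗[ℚ] D ≃ₐ[ℝ] Matrix (Fin 2) (Fin 2) ℝ)
    (e : Basis (Fin 4) ℚ D) :
    ∃ b : Basis (Fin 4) ℝ (Matrix (Fin 2) (Fin 2) ℝ),
      (∀ x ∈ matrixLattice b, ∀ y ∈ matrixLattice b, x * y ∈ matrixLattice b) ∧
      (∀ x ∈ matrixLattice b, x ≠ 0 → x.det ≠ 0) ∧
      ∃ M : ℤ, M ≠ 0 ∧ ∀ g ∈ latticeStabilizer b, ∀ k, ∃ z : ℤ,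
        (M : ℝ) * (e.baseChange ℝ).repr (Φ.symm (g : Matrix (Fin 2) (Fin 2) ℝ)) k = z := by
  obtain ⟨N, hN, hc⟩ := exists_int_mul_rat
    fun p : Fin 4 × Fin 4 × Fin 4 => e.repr (e p.1 * e p.2.1) p.2.2
  have hNQ : (N : ℚ) ≠ 0 := Int.cast_ne_zero.2 hN
  have hNR : (N : ℝ) ≠ 0 := Int.cast_ne_zero.2 hN
  -- If `N` clears the structure constants of `e`, those of `N e` are `N` times the old ones, hence
  -- integers.
  let f : Basis (Fin 4) ℚ D := e.unitsSMul fun _ => Units.mk0 (N : ℚ) hNQ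
  have hf : ∀ i, f i = (N : ℚ) • e i := fun i => e.unitsSMul_apply i
  let ι : D →+* Matrix (Fin 2) (Fin 2) ℝ :=
    (Φ : ℝ ⊗[ℚ] D →+* Matrix (Fin 2) (Fin 2) ℝ).comp
      (Algebra.TensorProduct.includeRight : D →ₐ[ℚ] ℝ ⊗[ℚ] D).toRingHom
  let b : Basis (Fin 4) ℝ (Matrix (Fin 2) (Fin 2) ℝ) :=
    ((e.baseChange ℝ).map Φ.toLinearEquiv).unitsSMul fun _ => Units.mk0 (N : ℝ) hNR
  have hb : ∀ i, b i = ι (f i) := fun i => by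
    rw [hf, Int.cast_smul_eq_zsmul, map_zsmul, ← Int.cast_smul_eq_zsmul ℝ, Basis.unitsSMul_apply,
      Basis.map_apply, Basis.baseChange_apply]
    rfl
  have hrepr : ∀ x k, (e.baseChange ℝ).repr (Φ.symm x) k = N * b.repr x k := fun x k => by
    rw [Basis.repr_unitsSMul, Units.smul_def, Units.val_inv_eq_inv_val, Units.val_mk0, smul_eq_mul,
      mul_inv_cancel_left₀ hNR]
    rfl
  have hmap : matrixLattice b =
      (Submodule.span ℤ (Set.range f)).map ι.toAddMonoidHom.toIntLinearMap := by
    rw [Submodule.map_span, ← Set.range_comp]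
    exact congrArg (fun g => Submodule.span ℤ (Set.range g)) (funext hb)
  have hfmul : Submodule.span ℤ (Set.range f) * Submodule.span ℤ (Set.range f) ≤
      Submodule.span ℤ (Set.range f) := by
    rw [Submodule.span_mul_span, Submodule.span_le]
    rintro _ ⟨_, ⟨i, rfl⟩, _, ⟨j, rfl⟩, rfl⟩
    refine (f.mem_span_iff_repr_mem ℤ _).2 fun k => ?_
    obtain ⟨z, hz⟩ := hc (i, j, k)
    refine ⟨z, ?_⟩
    rw [Basis.repr_unitsSMul]
    simp only [hf, smul_mul_smul_comm, map_smul, Finsupp.smul_apply, Units.smul_def,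
      Units.val_inv_eq_inv_val, Units.val_mk0, smul_eq_mul, mul_assoc]
    rw [inv_mul_cancel_left₀ hNQ, hz]
    simp
  refine ⟨b, ?_, ?_, ?_⟩
  · rw [hmap]
    rintro _ ⟨x, hx, rfl⟩ _ ⟨y, hy, rfl⟩
    exact ⟨x * y, hfmul (Submodule.mul_mem_mul hx hy), map_mul ι x y⟩
  · rw [hmap]
    rintro _ ⟨x, hx, rfl⟩ hx0
    have hx0' : x ≠ 0 := fun h => hx0 (by rw [h, map_zero])
    exact (((Matrix.isUnit_iff_isUnit_det _).1 (hx0'.isUnit.map ι))).ne_zero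
  -- The lattice need not contain `1`, but it contains some nonzero integer `M`; then `g M` lies in
  -- the lattice for `g` in the stabilizer.
  · obtain ⟨M, hM, h1⟩ := exists_int_mul_rat fun k => f.repr 1 k
    have hM1 : (M : Matrix (Fin 2) (Fin 2) ℝ) ∈ matrixLattice b := by
      rw [hmap]
      refine ⟨(M : D), (f.mem_span_iff_repr_mem ℤ _).2 fun k => ?_, map_intCast ι M⟩
      obtain ⟨z, hz⟩ := h1 k
      refine ⟨z, ?_⟩
      rw [← zsmul_one, ← Int.cast_smul_eq_zsmul ℚ, map_smul, Finsupp.smul_apply, smul_eq_mul, hz]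
      simp
    refine ⟨M, hM, fun g hg k => ?_⟩
    obtain ⟨z, hz⟩ := (b.mem_span_iff_repr_mem ℤ _).1 (hg _ hM1).1 k
    refine ⟨N * z, ?_⟩
    rw [← zsmul_one, mul_smul_comm, mul_one, ← Int.cast_smul_eq_zsmul ℝ, map_smul,
      Finsupp.smul_apply, smul_eq_mul] at hz
    rw [hrepr, mul_left_comm, ← hz]
    simp

theorem continuous_coordinates (Φ : ℝ ⊗[ℚ] D ≃ₐ[ℝ] Matrix (Fin 2) (Fin 2) ℝ)
    (e : Basis (Fin 4) ℚ D) :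
    Continuous fun (g : SL(2, ℝ)) k =>
      (e.baseChange ℝ).repr (Φ.symm (g : Matrix (Fin 2) (Fin 2) ℝ)) k :=
  (LinearMap.continuous_of_finiteDimensional
    ((Φ.symm.toLinearEquiv.trans (e.baseChange ℝ).equivFun :
      Matrix (Fin 2) (Fin 2) ℝ ≃ₗ[ℝ] (Fin 4 → ℝ)) :
        Matrix (Fin 2) (Fin 2) ℝ →ₗ[ℝ] (Fin 4 → ℝ))).comp
    Matrix.SpecialLinearGroup.isClosedEmbedding_val.continuous

/-- A subgroup of `SL₂(ℝ)` with coordinates of bounded denominators is discrete. -/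
theorem discreteTopology_of_coordinates (Φ : ℝ ⊗[ℚ] D ≃ₐ[ℝ] Matrix (Fin 2) (Fin 2) ℝ)
    (e : Basis (Fin 4) ℚ D) (Γ₀ : Subgroup SL(2, ℝ)) {M : ℤ} (hM : M ≠ 0)
    (h : ∀ g ∈ Γ₀, ∀ k, ∃ z : ℤ,
      (M : ℝ) * (e.baseChange ℝ).repr (Φ.symm (g : Matrix (Fin 2) (Fin 2) ℝ)) k = z) :
    DiscreteTopology Γ₀ := by
  let f : Γ₀ → Submodule.span ℤ (Set.range (Pi.basisFun ℝ (Fin 4))) := fun g =>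
    ⟨fun k => (M : ℝ) * (e.baseChange ℝ).repr (Φ.symm (g : Matrix (Fin 2) (Fin 2) ℝ)) k,
      (Basis.mem_span_iff_repr_mem ℤ _ _).2 fun k => by
        obtain ⟨z, hz⟩ := h g g.2 k
        exact ⟨z, by simp [hz]⟩⟩
  refine DiscreteTopology.of_continuous_injective (f := f) ?_ fun x y hxy => ?_
  · exact (continuous_const.mul
      ((continuous_coordinates Φ e).comp continuous_subtype_val)).subtype_mk _
  · refine Subtype.ext (Subtype.ext (Φ.symm.injective ((e.baseChange ℝ).repr.injective ?_)))
    ext k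
    exact mul_left_cancel₀ (Int.cast_ne_zero.2 hM) (congrFun (congrArg Subtype.val hxy) k)

end Order

/-! ### Continuity of the action and conclusion -/

theorem continuous_representation {G : Type*} [Group G] [TopologicalSpace G] {n : ℕ}
    {φ : Representation ℝ G (Fin n → ℝ)} (v : Basis (Fin n) ℝ (Fin n → ℝ))
    (h : ∀ i j, Continuous fun g => LinearMap.toMatrix v v (φ g) i j) :
    Continuous fun p : G × (Fin n → ℝ) => φ p.1 p.2 := by
  have h1 : Continuous v.equivFun := LinearMap.continuous_of_finiteDimensional
    (v.equivFun : (Fin n → ℝ) →ₗ[ℝ] (Fin n → ℝ))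
  have h2 : Continuous v.equivFun.symm := LinearMap.continuous_of_finiteDimensional
    (v.equivFun.symm : (Fin n → ℝ) →ₗ[ℝ] (Fin n → ℝ))
  have h3 : Continuous fun p : G × (Fin n → ℝ) =>
      (LinearMap.toMatrix v v (φ p.1)).mulVec (v.equivFun p.2) :=
    ((continuous_matrix h).comp continuous_fst).matrix_mulVec (h1.comp continuous_snd)
  convert! h2.comp h3 using 2 with p
  refine (v.equivFun.symm_apply_eq.2 ?_).symm
  exact LinearMap.toMatrix_mulVec_repr v v (φ p.1) p.2

end SemidirectLattice

open SemidirectLattice in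
theorem mainTheorem7 {D : Type*} [DivisionRing D] [Algebra ℚ D] [Algebra.IsCentral ℚ D]
    (hD : Module.finrank ℚ D = 4)
    (Φ : ℝ ⊗[ℚ] D ≃ₐ[ℝ] Matrix (Fin 2) (Fin 2) ℝ)
    (n : ℕ) (φ : Representation ℝ SL(2, ℝ) (Fin n → ℝ))
    (hφ : SemidirectLattice.IsDefinedOverRat Φ φ) :
    ∃ Γ : Subgroup (SemidirectLattice.VectorSemidirect φ),
      SemidirectLattice.IsCocompactLattice Γ := by
  obtain ⟨e, v, P, hP⟩ := hφ
  have hP' : ∀ (g : SL(2, ℝ)) (i j : Fin n), LinearMap.toMatrix v v (φ g) i j =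
      MvPolynomial.aeval
        (fun k => (e.baseChange ℝ).repr (Φ.symm (g : Matrix (Fin 2) (Fin 2) ℝ)) k) (P i j) := by
    intro g i j
    have := hP ((SL1.equiv Φ).symm g) i j
    rw [MulEquiv.apply_symm_apply] at this
    exact this
  obtain ⟨b, hmul, hdet, M, hM, hden⟩ := exists_basis_matrixLattice Φ e
  have := discreteTopology_of_coordinates Φ e (latticeStabilizer b) hM hden
  obtain ⟨K, hK, hcov⟩ := exists_isCompact_mul_latticeStabilizer hmul hdet
  have hcont : Continuous fun p : SL(2, ℝ) × (Fin n → ℝ) => φ p.1 p.2 := by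
    refine continuous_representation v fun i j => ?_
    simp_rw [hP', MvPolynomial.aeval_def, MvPolynomial.eval₂_eq_eval_map]
    exact (MvPolynomial.continuous_eval _).comp (continuous_coordinates Φ e)
  choose N hN hNP using fun p : Fin n × Fin n => exists_int_mul_aeval hM (P p.1 p.2)
  have : SecondCountableTopology (Matrix (Fin 2) (Fin 2) ℝ) :=
    inferInstanceAs (SecondCountableTopology (Fin 2 → Fin 2 → ℝ))
  have : LocallyCompactSpace (Matrix (Fin 2) (Fin 2) ℝ) :=
    inferInstanceAs (LocallyCompactSpace (Fin 2 → Fin 2 → ℝ))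
  have : SecondCountableTopology SL(2, ℝ) :=
    Matrix.SpecialLinearGroup.isClosedEmbedding_val.isInducing.secondCountableTopology
  have : LocallyCompactSpace SL(2, ℝ) :=
    Matrix.SpecialLinearGroup.isClosedEmbedding_val.locallyCompactSpace
  refine ⟨_, isCocompactLattice_semidirectSubgroup φ v (latticeStabilizer b) hcont hK hcov
    (N := ∏ p, N p) (Finset.prod_ne_zero_iff.2 fun p _ => hN p) fun g hg j => ?_⟩
  refine (v.mem_span_iff_repr_mem ℤ _).2 fun i => ?_
  obtain ⟨z, hz⟩ := hNP (i, j) _ (hden g hg)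
  -- The product of the denominators of all matrix entries serves as a common one.
  obtain ⟨c, hc⟩ := Finset.dvd_prod_of_mem N (Finset.mem_univ (i, j))
  refine ⟨c * z, ?_⟩
  rw [map_smul, Finsupp.smul_apply, ← LinearMap.toMatrix_apply, hP', hc, smul_eq_mul]
  push_cast
  rw [mul_right_comm, hz, mul_comm]
  simp
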